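/- Let $\mathbb{D}$ be the open unit disk and $dA=\pi^{-1}dx\,dy$. The Dirichlet space $\mathcal D$ is the Hilbert space of analytic functions $f$ on $\mathbb{D}$ with $\|f\|_{\mathcal D}^2=|f(0)|^2+\int_{\mathbb D}|f'|^2\,dA<\infty$. For a sequence $\boldsymbol\lambda=\{\lambda_n\}_{n\ge 0}$ of complex numbers and $f(z)=\sum_{k\ge 0}a_kz^k$ analytic on $\mathbb{D}$, put $$\mathcal H_{\boldsymbol\lambda}(f)(z)=\sum_{n=0}^\infty\Big(\sum_{k=0}^\infty\lambda_{n+k}a_k\Big)z^n,\qquad z\in\mathbb D,$$ whenever all these series converge and define an analytic function on $\mathbb D$. The operator $\mathcal H_{\boldsymbol\lambda}$ is bounded on $\mathcal D$ if $\mathcal H_{\boldsymbol\lambda}(f)$ is well defined for every $f\in\mathcal D$ and there is a constant $C>0$ with $\mathcal H_{\boldsymbol\lambda}(f)\in\mathcal D$ and $\|\mathcal H_{\boldsymbol\lambda}(f)\|_{\mathcal D}\le C\|f\|_{\mathcal D}$ for all $f\in\mathcal D$; it is compact on $\mathcal D$ if it is well defined as a map from $\mathcal D$ to $\mathcal D$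 and is a compact operator. For $2<p<\infty$, a set $E\subseteq\mathbb Z$ is a Rudin $\Lambda(p)$ set if there is a constant $C$ such that $\|f\|_{L^p(\mathbb T)}\le C\|f\|_{L^2(\mathbb T)}$ for all trigonometric polynomials $f$ on the unit circle $\mathbb T$ whose Fourier coefficients vanish on $\mathbb Z\setminus E$. Corollary. Let $2<p<\infty$, let $E\subseteq\mathbb Z$ be a Rudin $\Lambda(p)$ set, and let $\boldsymbol\lambda=\{\lambda_n\}_{n\ge0}$ be a sequence of complex numbers with $\lambda_n=0$ for all $n\ge 0$ with $n\notin E$. Then the following statements are equivalent. (i) $\mathcal H_{\boldsymbol\lambda}$ is compact on $\mathcal D$. (ii) $\mathcal H_{\boldsymbol\lambda}$ is bounded on $\mathcal D$. (iii) The symbol $h_{\overline{\boldsymbol\lambda}}(z)=\sum_{n\in E,\,n\ge0}\overline{\lambda_n}z^n$ converges in $\mathbb D$ and belongs to $\mathcal D$; equivalently, $$\sum_{n\in E,\ n\ge 0}(n+1)|\lambda_n|^2<\infty.$$ -/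

import Mathlib

open scoped ComplexConjugate

noncomputable section

namespace DirichletHankel

/-- The open unit disk. -/
abbrev disk : Set ℂ := Metric.ball (0 : ℂ) 1

/-- The normalized area measure `dA = π⁻¹ dx dy` on the open unit disk. -/
def diskMeasure : MeasureTheory.Measure ℂ :=
  ENNReal.ofReal (Real.pi⁻¹) • MeasureTheory.volume.restrict disk

/-- Analytic functions on the disk with square-integrable derivative. A function on the disk is
represented by its extension by zero to `ℂ`, so that two members are equal exactly when they
agree on the disk. -/
def dirichletSubmodule : Submodule ℂ (ℂ → ℂ) where
  carrier := {f | DifferentiableOn ℂ f disk ∧ MeasureTheory.MemLp (deriv f) 2 diskMeasure ∧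
    ∀ z, z ∉ disk → f z = 0}
  zero_mem' := by
    refine ⟨differentiableOn_const 0, ?_, fun _ _ => rfl⟩
    have h : deriv (0 : ℂ → ℂ) = 0 := by
      funext z
      exact deriv_const z 0
    rw [h]
    exact MeasureTheory.MemLp.zero
  add_mem' := by
    rintro f g ⟨hf, hf2, hf0⟩ ⟨hg, hg2, hg0⟩
    refine ⟨hf.add hg, ?_, fun z hz => by simp [hf0 z hz, hg0 z hz]⟩
    refine (hf2.add hg2).ae_eq ?_
    refine MeasureTheory.Measure.ae_smul_measure ?_ _
    filter_upwards [MeasureTheory.ae_restrict_mem measurableSet_ball] with z hz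
    have hn := Metric.isOpen_ball.mem_nhds hz
    exact (deriv_add (hf.differentiableAt hn) (hg.differentiableAt hn)).symm
  smul_mem' := by
    rintro c f ⟨hf, hf2, hf0⟩
    refine ⟨hf.const_smul c, ?_, fun z hz => by simp [hf0 z hz]⟩
    refine (hf2.const_smul c).ae_eq ?_
    refine MeasureTheory.Measure.ae_smul_measure ?_ _
    filter_upwards [MeasureTheory.ae_restrict_mem measurableSet_ball] with z hz
    have hn := Metric.isOpen_ball.mem_nhds hz
    exact (deriv_const_smul c (hf.differentiableAt hn)).symm

/-- The Dirichlet space `𝒟` of the unit disk. -/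
def DirichletSpace : Type := dirichletSubmodule

namespace DirichletSpace

instance : AddCommGroup DirichletSpace := inferInstanceAs (AddCommGroup dirichletSubmodule)

instance : Module ℂ DirichletSpace := inferInstanceAs (Module ℂ dirichletSubmodule)

instance : CoeFun DirichletSpace (fun _ => ℂ → ℂ) := ⟨fun f => f.1⟩

theorem memLp_deriv (f : DirichletSpace) : MeasureTheory.MemLp (deriv f) 2 diskMeasure := f.2.2.1

theorem ae_deriv_add (f g : DirichletSpace) :
    deriv (f + g : DirichletSpace) =ᵐ[diskMeasure] deriv f + deriv g := by
  refine MeasureTheory.Measure.ae_smul_measure ?_ _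
  filter_upwards [MeasureTheory.ae_restrict_mem measurableSet_ball] with z hz
  have hn := Metric.isOpen_ball.mem_nhds hz
  exact deriv_add (f.2.1.differentiableAt hn) (g.2.1.differentiableAt hn)

theorem ae_deriv_smul (c : ℂ) (f : DirichletSpace) :
    deriv (c • f : DirichletSpace) =ᵐ[diskMeasure] c • deriv f := by
  refine MeasureTheory.Measure.ae_smul_measure ?_ _
  filter_upwards [MeasureTheory.ae_restrict_mem measurableSet_ball] with z hz
  have hn := Metric.isOpen_ball.mem_nhds hz
  exact deriv_const_smul c (f.2.1.differentiableAt hn)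

theorem integrable_inner (f g : DirichletSpace) :
    MeasureTheory.Integrable (fun z => conj (deriv f z) * deriv g z) diskMeasure :=
  MeasureTheory.MemLp.integrable_mul f.memLp_deriv.star g.memLp_deriv

/-- The Dirichlet inner product, conjugate-linear in its first argument as usual in Mathlib:
`⟪f, g⟫ = conj (f 0) * g 0 + ∫_𝔻 conj (f') * g' dA`. -/
@[reducible]
def core : InnerProductSpace.Core ℂ DirichletSpace where
  inner f g := conj (f 0) * g 0 + ∫ z, conj (deriv f z) * deriv g z ∂diskMeasure
  conj_inner_symm f g := by
    rw [map_add, ← integral_conj]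
    simp [mul_comm]
  re_inner_nonneg f := by
    have h : (fun z => conj (deriv f z) * deriv f z) = fun z => ((‖deriv f z‖ ^ 2 : ℝ) : ℂ) := by
      funext z
      rw [Complex.conj_mul']
      norm_cast
    rw [h, integral_complex_ofReal, Complex.conj_mul']
    have h2 : 0 ≤ ∫ z, ‖deriv f z‖ ^ 2 ∂diskMeasure :=
      MeasureTheory.integral_nonneg fun z => by positivity
    have h3 : 0 ≤ ‖f 0‖ ^ 2 := by positivity
    simpa [← Complex.ofReal_pow] using add_nonneg h3 h2
  add_left f g h := by
    have e : (fun z => conj (deriv (f + g : DirichletSpace) z) * deriv h z) =ᵐ[diskMeasure]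
        fun z => conj (deriv f z) * deriv h z + conj (deriv g z) * deriv h z := by
      filter_upwards [ae_deriv_add f g] with z hz
      simp [hz, add_mul]
    rw [MeasureTheory.integral_congr_ae e,
      MeasureTheory.integral_add (integrable_inner f h) (integrable_inner g h)]
    have e0 : (f + g : DirichletSpace) 0 = f 0 + g 0 := rfl
    rw [e0, map_add]
    ring
  smul_left f g c := by
    have e : (fun z => conj (deriv (c • f : DirichletSpace) z) * deriv g z) =ᵐ[diskMeasure]
        fun z => conj c * (conj (deriv f z) * deriv g z) := by
      filter_upwards [ae_deriv_smul c f] with z hz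
      simp [hz, mul_assoc]
    rw [MeasureTheory.integral_congr_ae e, MeasureTheory.integral_const_mul]
    have e0 : (c • f : DirichletSpace) 0 = c * f 0 := rfl
    rw [e0, map_mul]
    ring
  definite f hf := by
    have h : (fun z => conj (deriv f z) * deriv f z) = fun z => ((‖deriv f z‖ ^ 2 : ℝ) : ℂ) := by
      funext z
      rw [Complex.conj_mul']
      norm_cast
    rw [h, integral_complex_ofReal, Complex.conj_mul'] at hf
    have h2 : 0 ≤ ∫ z, ‖deriv f z‖ ^ 2 ∂diskMeasure :=
      MeasureTheory.integral_nonneg fun z => by positivity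
    have h3 : 0 ≤ ‖f 0‖ ^ 2 := by positivity
    have hf' : ‖f 0‖ ^ 2 + ∫ z, ‖deriv f z‖ ^ 2 ∂diskMeasure = 0 := by
      exact_mod_cast hf
    have h0 : f 0 = 0 := by
      have : ‖f 0‖ ^ 2 = 0 := by linarith
      simpa using this
    have hI : ∫ z, ‖deriv f z‖ ^ 2 ∂diskMeasure = 0 := by linarith
    have hint : MeasureTheory.Integrable (fun z => ‖deriv f z‖ ^ 2) diskMeasure :=
      f.memLp_deriv.integrable_norm_pow (by norm_num)
    rw [MeasureTheory.integral_eq_zero_iff_of_nonneg (fun z => by positivity) hint] at hI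
    have hc : ENNReal.ofReal (Real.pi⁻¹) ≠ 0 := by
      simp [Real.pi_pos]
    have hae : deriv f =ᵐ[MeasureTheory.volume.restrict disk] fun _ => (0 : ℂ) := by
      have hI' := (MeasureTheory.Measure.ae_ennreal_smul_measure_iff hc).1 hI
      filter_upwards [hI'] with z hz
      simpa using hz
    have hd : Set.EqOn (deriv f) (fun _ => (0 : ℂ)) disk :=
      MeasureTheory.Measure.eqOn_open_of_ae_eq hae Metric.isOpen_ball
        (f.2.1.deriv Metric.isOpen_ball).continuousOn continuousOn_const
    refine Subtype.ext (funext fun z => ?_)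
    by_cases hz : z ∈ disk
    · have := Metric.isOpen_ball.is_const_of_deriv_eq_zero
        (convex_ball (0 : ℂ) 1).isPreconnected f.2.1 hd hz (Metric.mem_ball_self one_pos)
      exact this.trans h0
    · exact f.2.2.2 z hz

instance : NormedAddCommGroup DirichletSpace := core.toNormedAddCommGroup

instance : InnerProductSpace ℂ DirichletSpace := InnerProductSpace.ofCore core.toCore

/-- The inner product of the Dirichlet space in explicit form. -/
theorem inner_def (f g : DirichletSpace) :
    inner ℂ f g = conj (f 0) * g 0 + ∫ z, conj (deriv f z) * deriv g z ∂diskMeasure := rfl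

/-- The squared norm of the Dirichlet space in explicit form. -/
theorem norm_sq (f : DirichletSpace) :
    ‖f‖ ^ 2 = ‖f 0‖ ^ 2 + ∫ z, ‖deriv f z‖ ^ 2 ∂diskMeasure := by
  have h : (fun z => conj (deriv f z) * deriv f z) = fun z => ((‖deriv f z‖ ^ 2 : ℝ) : ℂ) := by
    funext z
    rw [Complex.conj_mul']
    norm_cast
  have h1 := inner_self_eq_norm_sq_to_K (𝕜 := ℂ) f
  rw [inner_def, h, integral_complex_ofReal, Complex.conj_mul'] at h1
  exact Complex.ofReal_injective (by simpa using h1.symm)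

end DirichletSpace

/-- The `k`-th Taylor coefficient at the origin. -/
def taylorCoeff (f : ℂ → ℂ) (k : ℕ) : ℂ := iteratedDeriv k f 0 / (k.factorial : ℂ)

/-- `g` is the image of `f = ∑ a_k z^k` under the Hankel matrix `(l (j + k))`: every series
`b_n = ∑_k l (n + k) a_k` converges (as the limit of its partial sums), and the power series
`∑ b_n z^n` converges at every point `z` of the disk, with sum `g z`. -/
def IsHankelImage (l : ℕ → ℂ) (f g : ℂ → ℂ) : Prop :=
  ∃ b : ℕ → ℂ,
    (∀ n, Filter.Tendsto (fun N => ∑ k ∈ Finset.range N, l (n + k) * taylorCoeff f k)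
      Filter.atTop (nhds (b n))) ∧
    ∀ z ∈ disk, HasSum (fun n => b n * z ^ n) (g z)

/-- `T` is the Hankel type operator with matrix `(l (j + k))` on the Dirichlet space: for every
`f`, the Hankel image of `f` exists and is `T f`. Such a `T` is unique, if it exists. -/
def IsHankelOperator (l : ℕ → ℂ) (T : DirichletSpace → DirichletSpace) : Prop :=
  ∀ f : DirichletSpace, IsHankelImage l f (T f)

/-- The Hankel type operator with matrix `(l (j + k))` is bounded on the Dirichlet space. -/
def HankelBounded (l : ℕ → ℂ) : Prop :=
  ∃ T, IsHankelOperator l T ∧ ∃ C : ℝ, 0 < C ∧ ∀ f, ‖T f‖ ≤ C * ‖f‖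

/-- The Hankel type operator with matrix `(l (j + k))` is compact on the Dirichlet space. -/
def HankelCompact (l : ℕ → ℂ) : Prop :=
  ∃ T, IsHankelOperator l T ∧ IsCompactOperator T

/-- The symbol `∑ conj (l n) z^n` converges in the disk and belongs to the Dirichlet space. -/
def SymbolInDirichlet (l : ℕ → ℂ) : Prop :=
  ∃ h : DirichletSpace, ∀ z ∈ disk, HasSum (fun n => conj (l n) * z ^ n) (h z)

/-- The trigonometric polynomial with the coefficients `c`, on the circle parametrized by
`t ↦ exp (2 π i t)`. -/
def trigPoly (c : ℤ →₀ ℂ) (t : UnitAddCircle) : ℂ :=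
  c.sum fun n a => a * fourier n t

/-- Rudin's `Λ(p)` sets, for `2 < p < ∞`: the `L^p` norm of a trigonometric polynomial with
coefficients supported in `E` is at most a constant multiple of its `L^2` norm. The norms are
those of the normalized Lebesgue measure of the circle. -/
def IsLambdaSet (p : ℝ) (E : Set ℤ) : Prop :=
  ∃ C : NNReal, ∀ c : ℤ →₀ ℂ, (∀ n, n ∉ E → c n = 0) →
    MeasureTheory.eLpNorm (trigPoly c) (ENNReal.ofReal p) AddCircle.haarAddCircle ≤
      C * MeasureTheory.eLpNorm (trigPoly c) 2 AddCircle.haarAddCircle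

end DirichletHankel

end

/-!
The operator is controlled on the side of the coefficients. Let `a_k` be the Taylor coefficients of
`f` and `c_n = ∑ λ_{n+k} a_k` those of its Hankel image. For `n ≥ j` only the tail
`Λ_j = ∑_{m ≥ j} λ_m z^m` of the symbol enters `c_n`, and `c_n` is a Fourier coefficient of the
product of `Λ_j` with a reflection of `f` on the circle. Bessel's and Hölder's inequalities, with
`1/2 = 1/p + 1/s`, together with the `Λ(p)` condition for `Λ_j` give
`∑_{n ≥ j} |c_n|² ≤ ‖Λ_j‖_p² ‖f‖_s² ≤ C ‖Λ_j‖_2² ‖f‖_s²`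
(`IsLambdaSet.exists_sum_norm_sq_le`). As `n + 1` is the number of `j ≤ n`, summation over `j` gives
`∑_{n ≥ N} (n + 1) |c_n|² ≤ C ‖f‖_s² ∑_{m ≥ N} (m + 1) |λ_m|²`
(`IsLambdaSet.exists_sum_weighted_norm_sq_le`). For `N = 0` this is the boundedness of the operator,
and for `N → ∞` it says that the operator is the limit in norm of its truncations to the first `N`
coefficients, which have finite rank; so it is compact (`IsLambdaSet.hankelCompact`).

Two facts about the Dirichlet space are needed. It embeds into `L^s` of the circle for every
`s < ∞` (`exists_eLpNorm_eval_toCircle_le`): for `s = 2j`, expand `f ^ j` and apply the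
Cauchy–Schwarz inequality with the weights `1 / (k + 1)`, whose `j`-fold convolution is bounded. Its
norm is a weighted `ℓ²` norm of the Taylor coefficients
(`DirichletSpace.hasSum_weight_mul_norm_taylorCoeff_sq`), by Parseval's identity on circles and
polar coordinates.

Conversely, the image of the constant function `1` is `∑ λ_n z^n`, so boundedness implies the
summability of `(n + 1) |λ_n|²`, which is also what it means for the symbol to lie in the space.
-/

noncomputable section

namespace DirichletHankel

open MeasureTheory AddCircle Filter Topology Polynomial
open scoped ENNReal ComplexConjugate

/-! ### Parseval's identity on the circle -/

theorem eLpNorm_natCast_pow {α E : Type*} [MeasurableSpace α] {μ : Measure α}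
    [NormedAddCommGroup E] {n : ℕ} (hn : n ≠ 0) (f : α → E) :
    eLpNorm f n μ ^ n = ∫⁻ x, ‖f x‖ₑ ^ n ∂μ := by
  have := eLpNorm_nnreal_pow_eq_lintegral (μ := μ) (f := f) (p := n) (by exact_mod_cast hn)
  simpa using this

/-- Parseval's identity for absolutely convergent power series on the circle. -/
theorem lintegral_enorm_sq_tsum_mul_toCircle_pow {T : ℝ} [Fact (0 < T)] {c : ℕ → ℂ}
    (hc : Summable fun k => ‖c k‖) :
    ∫⁻ t : AddCircle T, ‖∑' k, c k * (toCircle t : ℂ) ^ k‖ₑ ^ 2 ∂haarAddCircle =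
      ∑' k, ‖c k‖ₑ ^ 2 := by
  have hs : Summable fun k : ℕ => c k • (fourier (k : ℤ) : C(AddCircle T, ℂ)) := by
    refine .of_norm ?_
    simpa [norm_smul, fourier_norm] using hc
  set φ : C(AddCircle T, ℂ) := ∑' k : ℕ, c k • (fourier (k : ℤ) : C(AddCircle T, ℂ)) with hφ
  have hφt (t : AddCircle T) : φ t = ∑' k, c k * (toCircle t : ℂ) ^ k := by
    rw [hφ, ← ContinuousMap.tsum_apply hs]
    simp [toCircle_nsmul]
  simp_rw [← hφt]
  have h1 : ∫⁻ t : AddCircle T, ‖φ t‖ₑ ^ 2 ∂haarAddCircle =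
      ‖ContinuousMap.toLp (E := ℂ) 2 haarAddCircle ℂ φ‖ₑ ^ 2 := by
    rw [Lp.enorm_def, eLpNorm_congr_ae (ContinuousMap.coeFn_toLp haarAddCircle φ)]
    exact (eLpNorm_natCast_pow two_ne_zero φ).symm
  have h2 : HasSum (fun k : ℕ => c k • fourierLp (T := T) 2 (k : ℤ))
      (ContinuousMap.toLp (E := ℂ) 2 haarAddCircle ℂ φ) := by
    have := (ContinuousMap.toLp (E := ℂ) 2 (haarAddCircle (T := T)) ℂ).hasSum hs.hasSum
    simpa using this
  have h3 : Tendsto (fun s : Finset ℕ => ∑ k ∈ s, ‖c k‖ₑ ^ 2) atTop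
      (𝓝 (‖ContinuousMap.toLp (E := ℂ) 2 (haarAddCircle (T := T)) ℂ φ‖ₑ ^ 2)) := by
    have h4 := ((ENNReal.continuous_pow 2).tendsto _).comp ((continuous_enorm.tendsto _).comp h2)
    refine h4.congr fun s => ?_
    have ho : Orthonormal ℂ (fun k : ℕ => fourierLp (T := T) 2 (k : ℤ)) :=
      orthonormal_fourier.comp _ Nat.cast_injective
    have h5 : ‖∑ k ∈ s, c k • fourierLp (T := T) 2 (k : ℤ)‖ ^ 2 = ∑ k ∈ s, ‖c k‖ ^ 2 := by
      have := ho.inner_sum c c s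
      rw [inner_self_eq_norm_sq_to_K] at this
      simp_rw [Complex.conj_mul'] at this
      apply Complex.ofReal_injective
      push_cast
      exact this
    have h6 := congrArg ENNReal.ofReal h5
    rw [ENNReal.ofReal_sum_of_nonneg (fun _ _ => by positivity)] at h6
    simpa [ENNReal.ofReal_pow] using h6
  rw [h1]
  exact tendsto_nhds_unique h3 ENNReal.summable.hasSum

/-- Parseval's identity for polynomials on the circle. -/
theorem lintegral_enorm_sq_eval_toCircle {T : ℝ} [Fact (0 < T)] (P : ℂ[X]) :
    ∫⁻ t : AddCircle T, ‖P.eval (toCircle t : ℂ)‖ₑ ^ 2 ∂haarAddCircle =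
      ∑' k, ‖P.coeff k‖ₑ ^ 2 := by
  have hz (k : ℕ) (hk : k ∉ P.support) : P.coeff k = 0 := by simpa using hk
  rw [← lintegral_enorm_sq_tsum_mul_toCircle_pow (T := T)
    (summable_of_ne_finset_zero (s := P.support) fun k hk => by simp [hz k hk])]
  refine lintegral_congr fun t => ?_
  rw [tsum_eq_sum (s := P.support) fun k hk => by simp [hz k hk], eval_eq_sum, Polynomial.sum]

/-! ### Polynomials in `L^s` of the circle and the Dirichlet norm -/

/-- The convolution powers of the sequence `1 / (k + 1)` decay like `1 / m`, up to powers of the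
harmonic numbers. -/
theorem coeff_mk_inv_pow_le (j m : ℕ) :
    0 ≤ PowerSeries.coeff m ((PowerSeries.mk fun k : ℕ => ((k : ℝ) + 1)⁻¹) ^ (j + 1)) ∧
    PowerSeries.coeff m ((PowerSeries.mk fun k : ℕ => ((k : ℝ) + 1)⁻¹) ^ (j + 1)) ≤
      (2 * (harmonic (m + 1) : ℝ)) ^ j / (m + 1) := by
  induction j generalizing m with
  | zero => simp; positivity
  | succ j ih =>
    rw [pow_succ, PowerSeries.coeff_mul]
    refine ⟨Finset.sum_nonneg fun x _ => mul_nonneg (ih _).1 (by simp; positivity), ?_⟩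
    have hH : ∀ n : ℕ, ((harmonic (n + 1) : ℚ) : ℝ) =
        ∑ k ∈ Finset.range (n + 1), ((k : ℝ) + 1)⁻¹ := by
      intro n
      simp [harmonic]
    have hH0 : ∀ n : ℕ, 0 ≤ ((harmonic (n + 1) : ℚ) : ℝ) := fun n => by
      rw [hH]; positivity
    have hmono : ∀ n ≤ m, ((harmonic (n + 1) : ℚ) : ℝ) ≤ (harmonic (m + 1) : ℚ) := by
      intro n hn
      rw [hH, hH]
      exact Finset.sum_le_sum_of_subset_of_nonneg (by simpa using hn)
        fun _ _ _ => by positivity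
    calc _ ≤ ∑ x ∈ Finset.HasAntidiagonal.antidiagonal m,
          (2 * (harmonic (m + 1) : ℝ)) ^ j / (m + 1) *
            (((x.1 : ℝ) + 1)⁻¹ + ((x.2 : ℝ) + 1)⁻¹) := by
          refine Finset.sum_le_sum fun x hx => ?_
          have hx' : x.1 + x.2 = m := by simpa using hx
          have h1 : (2 * (harmonic (x.1 + 1) : ℝ)) ^ j ≤ (2 * (harmonic (m + 1) : ℝ)) ^ j := by
            gcongr
            · exact mul_nonneg (by norm_num) (hH0 _)
            · exact_mod_cast hmono x.1 (by omega)
          have h0 : 0 ≤ (2 * (harmonic (m + 1) : ℝ)) ^ j :=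
            pow_nonneg (mul_nonneg (by norm_num) (hH0 _)) _
          rw [PowerSeries.coeff_mk]
          calc _ ≤ (2 * (harmonic (x.1 + 1) : ℝ)) ^ j / (x.1 + 1) * ((x.2 : ℝ) + 1)⁻¹ := by
                gcongr
                exact (ih _).2
            _ ≤ (2 * (harmonic (m + 1) : ℝ)) ^ j / (x.1 + 1) * ((x.2 : ℝ) + 1)⁻¹ := by gcongr
            _ ≤ _ := by
                have hm : (m : ℝ) = x.1 + x.2 := by exact_mod_cast hx'.symm
                -- `1 / ((a + 1) (b + 1)) = (1 / (a + 1) + 1 / (b + 1)) / (m + 2)` for `a + b = m`.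
                have e : (2 * (harmonic (m + 1) : ℝ)) ^ j / (m + 1) *
                    (((x.1 : ℝ) + 1)⁻¹ + ((x.2 : ℝ) + 1)⁻¹) =
                  (2 * (harmonic (m + 1) : ℝ)) ^ j / (x.1 + 1) * ((x.2 : ℝ) + 1)⁻¹ *
                    ((m + 2) / (m + 1)) := by
                  rw [hm]; field_simp; ring
                rw [e]
                refine le_mul_of_one_le_right (by positivity) ?_
                rw [one_le_div (by positivity)]
                linarith
      _ = _ := by
          have hswap := Finset.Nat.sum_antidiagonal_swap (n := m)
            (f := fun x => ((x.1 : ℝ) + 1)⁻¹)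
          simp only [Prod.fst_swap] at hswap
          rw [← Finset.mul_sum, Finset.sum_add_distrib, hswap,
            Finset.Nat.sum_antidiagonal_eq_sum_range_succ (fun a _ => ((a : ℝ) + 1)⁻¹), hH]
          simp only [Nat.succ_eq_add_one]
          ring

theorem exists_coeff_mk_inv_pow_le (j : ℕ) : ∃ C : ℝ, 0 ≤ C ∧ ∀ m,
    PowerSeries.coeff m ((PowerSeries.mk fun k : ℕ => ((k : ℝ) + 1)⁻¹) ^ (j + 1)) ≤ C := by
  have h1 : Tendsto (fun x : ℝ => (2 * (1 + Real.log x)) ^ j / x) atTop (𝓝 0) := by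
    -- With `y = e x` one has `1 + log x = log y`.
    have h0 := (Real.tendsto_pow_log_div_mul_add_atTop 1 0 j one_ne_zero).comp
      (tendsto_id.const_mul_atTop (Real.exp_pos 1))
    have h3 := h0.const_mul (2 ^ j * Real.exp 1)
    rw [mul_zero] at h3
    refine h3.congr' ?_
    filter_upwards [eventually_gt_atTop 0] with x hx
    simp only [Function.comp, id, one_mul, add_zero]
    rw [Real.log_mul (Real.exp_pos 1).ne' hx.ne', Real.log_exp, mul_pow]
    field_simp
  have h2 : Tendsto (fun m : ℕ => (2 * (1 + Real.log ((m + 1 : ℕ) : ℝ))) ^ j /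
      ((m + 1 : ℕ) : ℝ)) atTop (𝓝 0) :=
    h1.comp (tendsto_natCast_atTop_atTop.comp (tendsto_add_atTop_nat 1))
  obtain ⟨C, hC⟩ := h2.bddAbove_range
  refine ⟨max C 0, le_max_right _ _, fun m => (coeff_mk_inv_pow_le j m).2.trans ?_⟩
  refine le_max_of_le_left (le_trans ?_ (hC ⟨m, rfl⟩))
  have h0 : (0 : ℝ) ≤ harmonic (m + 1) := by
    simp only [harmonic, Rat.cast_sum]; positivity
  push_cast
  gcongr
  exact_mod_cast harmonic_le_one_add_log (m + 1)

/-- The polynomial with coefficients `(k + 1) * ‖a_k‖ ^ 2`, where `a_k` are those of `F`. Its value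
at `1` is the squared norm of `F` in the Dirichlet space, up to equivalence. -/
def dirichletDensity (F : ℂ[X]) : ℝ[X] :=
  ∑ k ∈ F.support, monomial k (((k : ℝ) + 1) * ‖F.coeff k‖ ^ 2)

theorem coeff_dirichletDensity (F : ℂ[X]) (k : ℕ) :
    (dirichletDensity F).coeff k = ((k : ℝ) + 1) * ‖F.coeff k‖ ^ 2 := by
  simp only [dirichletDensity, finsetSum_coeff, coeff_monomial, Finset.sum_ite_eq']
  split_ifs with h
  · rfl
  · simp [notMem_support_iff.1 h]

theorem coeff_dirichletDensity_pow_nonneg (F : ℂ[X]) (j m : ℕ) :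
    0 ≤ (dirichletDensity F ^ j).coeff m := by
  induction j generalizing m with
  | zero => rw [pow_zero, coeff_one]; split_ifs <;> simp
  | succ j ih =>
    rw [pow_succ, coeff_mul]
    refine Finset.sum_nonneg fun x _ => mul_nonneg (ih _) ?_
    rw [coeff_dirichletDensity]
    positivity

/-- The Cauchy–Schwarz inequality with the weights `1 / (k + 1)`, applied to the expansion of the
coefficients of a power of `F`. -/
theorem norm_coeff_pow_sq_le (F : ℂ[X]) (j m : ℕ) :
    ‖(F ^ (j + 1)).coeff m‖ ^ 2 ≤
      PowerSeries.coeff m ((PowerSeries.mk fun k : ℕ => ((k : ℝ) + 1)⁻¹) ^ (j + 1)) *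
        (dirichletDensity F ^ (j + 1)).coeff m := by
  induction j generalizing m with
  | zero =>
    simp only [zero_add, pow_one, PowerSeries.coeff_mk, coeff_dirichletDensity]
    rw [inv_mul_cancel_left₀ (by positivity)]
  | succ j ih =>
    rw [pow_succ F, pow_succ (dirichletDensity F), pow_succ (PowerSeries.mk _), coeff_mul,
      coeff_mul,
      PowerSeries.coeff_mul]
    calc _ ≤ (∑ x ∈ Finset.HasAntidiagonal.antidiagonal m,
          ‖(F ^ (j + 1)).coeff x.1 * F.coeff x.2‖) ^ 2 := by
          gcongr
          exact norm_sum_le _ _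
      _ ≤ _ := by
          refine Finset.sum_sq_le_sum_mul_sum_of_sq_le_mul _ (fun x _ => ?_) (fun x _ => ?_)
            fun x _ => ?_
          · exact mul_nonneg (coeff_mk_inv_pow_le j _).1 (by simp; positivity)
          · refine mul_nonneg (coeff_dirichletDensity_pow_nonneg _ _ _) ?_
            rw [coeff_dirichletDensity]
            positivity
          · rw [norm_mul, mul_pow, PowerSeries.coeff_mk, coeff_dirichletDensity,
              mul_mul_mul_comm, inv_mul_cancel_left₀ (by positivity)]
            gcongr
            exact ih _

/-- Polynomials are bounded in `L ^ (2 (j + 1))` of the circle by their norm in the Dirichlet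
space. -/
theorem exists_eLpNorm_eval_toCircle_le (T : ℝ) [Fact (0 < T)] (j : ℕ) :
    ∃ C : ℝ, 0 ≤ C ∧ ∀ F : ℂ[X],
      eLpNorm (fun t : AddCircle T => F.eval (toCircle t : ℂ)) (2 * (j + 1) : ℕ) haarAddCircle ≤
        ENNReal.ofReal (C * √((dirichletDensity F).eval 1)) := by
  obtain ⟨C, hC0, hC⟩ := exists_coeff_mk_inv_pow_le j
  -- A crude bound that avoids extracting a root of `C`.
  have hC1 : C ≤ (C + 1) ^ (2 * (j + 1)) :=
    (by linarith : C ≤ C + 1).trans (le_self_pow₀ (by linarith) (by omega))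
  refine ⟨C + 1, by linarith, fun F => ?_⟩
  have hD0 : 0 ≤ (dirichletDensity F).eval 1 := by
    rw [eval_eq_sum, Polynomial.sum]
    refine Finset.sum_nonneg fun k _ => ?_
    simpa using coeff_dirichletDensity_pow_nonneg F 1 k
  rw [← ENNReal.pow_le_pow_left_iff (n := 2 * (j + 1)) (by omega),
    eLpNorm_natCast_pow (by omega), ← ENNReal.ofReal_pow (by positivity)]
  have h1 (t : AddCircle T) : ‖F.eval (toCircle t : ℂ)‖ₑ ^ (2 * (j + 1)) =
      ‖(F ^ (j + 1)).eval (toCircle t : ℂ)‖ₑ ^ 2 := by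
    rw [eval_pow, enorm_pow, ← pow_mul, mul_comm]
  simp_rw [h1]
  rw [lintegral_enorm_sq_eval_toCircle]
  set B := dirichletDensity F ^ (j + 1) with hB
  have hB0 := coeff_dirichletDensity_pow_nonneg F (j + 1)
  rw [← hB] at hB0
  calc ∑' k, ‖(F ^ (j + 1)).coeff k‖ₑ ^ 2 ≤ ∑' k, ENNReal.ofReal (C * B.coeff k) := by
        refine ENNReal.tsum_le_tsum fun k => ?_
        rw [← ofReal_norm, ← ENNReal.ofReal_pow (norm_nonneg _)]
        refine ENNReal.ofReal_le_ofReal ((norm_coeff_pow_sq_le F j k).trans ?_)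
        exact mul_le_mul_of_nonneg_right (hC k) (hB0 k)
    _ = ENNReal.ofReal (C * B.eval 1) := by
        rw [tsum_eq_sum (s := B.support) fun k hk => by simp [notMem_support_iff.1 hk],
          ← ENNReal.ofReal_sum_of_nonneg fun k _ => mul_nonneg hC0 (hB0 k), ← Finset.mul_sum,
          eval_eq_sum, Polynomial.sum]
        simp
    _ ≤ _ := by
        refine ENNReal.ofReal_le_ofReal ?_
        rw [mul_pow, pow_mul (√_), Real.sq_sqrt hD0, hB, eval_pow]
        gcongr

/-! ### The Hankel inequality for finite sums -/

/-- The form in which Rudin's condition is used: an `L ^ p` bound for polynomials with exponents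
in the `Λ(p)` set. -/
theorem IsLambdaSet.exists_eLpNorm_le {p : ℝ} {E : Set ℤ} (hE : IsLambdaSet p E) :
    ∃ C : NNReal, ∀ P : ℂ[X], (∀ n : ℕ, (n : ℤ) ∉ E → P.coeff n = 0) →
      eLpNorm (fun t : UnitAddCircle => P.eval (toCircle t : ℂ)) (ENNReal.ofReal p)
          haarAddCircle ≤
        C * eLpNorm (fun t : UnitAddCircle => P.eval (toCircle t : ℂ)) 2 haarAddCircle := by
  obtain ⟨C, hC⟩ := hE
  refine ⟨C, fun P hP => ?_⟩
  let c : ℤ →₀ ℂ := P.support.sum fun n => Finsupp.single (n : ℤ) (P.coeff n)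
  have hc : trigPoly c = fun t : UnitAddCircle => P.eval (toCircle t : ℂ) := by
    funext t
    rw [trigPoly, ← Finsupp.sum_finsetSum_index (by simp) (by intros; ring), eval_eq_sum,
      Polynomial.sum]
    refine Finset.sum_congr rfl fun n _ => ?_
    rw [Finsupp.sum_single_index (by simp)]
    simp [toCircle_nsmul]
  have := hC c fun n hn => by
    simp only [c, Finsupp.finsetSum_apply]
    refine Finset.sum_eq_zero fun k _ => ?_
    by_cases h : (k : ℤ) = n
    · rw [hP k (h ▸ hn)]; simp
    · rw [Finsupp.single_eq_of_ne (Ne.symm h)]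
  rwa [hc] at this

theorem continuous_eval_toCircle {T : ℝ} (P : ℂ[X]) :
    Continuous fun t : AddCircle T => P.eval (toCircle t : ℂ) :=
  P.continuous.comp (continuous_subtype_val.comp continuous_toCircle)

theorem eLpNorm_two_eval_toCircle_sq {T : ℝ} [Fact (0 < T)] (P : ℂ[X]) :
    eLpNorm (fun t : AddCircle T => P.eval (toCircle t : ℂ)) 2 haarAddCircle ^ 2 =
      ∑' k, ‖P.coeff k‖ₑ ^ 2 := by
  rw [← lintegral_enorm_sq_eval_toCircle (T := T)]
  exact eLpNorm_natCast_pow two_ne_zero _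

/-- The coefficients of the Hankel image with index `n ≥ j` only see the terms of the symbol with
index at least `j`. They are Fourier coefficients of the product of this tail of the symbol with
the reflection of `∑ a_k z^k`, so Bessel's inequality, Hölder's inequality with
`1 / 2 = 1 / p + 1 / s`, the `Λ(p)` condition for the tail and the embedding of the Dirichlet space
into `L ^ s` bound their sum of squares. -/
theorem IsLambdaSet.exists_sum_norm_sq_le {p : ℝ} (hp : 2 < p) {E : Set ℤ}
    (hE : IsLambdaSet p E) :
    ∃ C : ℝ, 0 ≤ C ∧ ∀ l : ℕ → ℂ, (∀ n : ℕ, (n : ℤ) ∉ E → l n = 0) → ∀ (a : ℕ → ℂ) (j M K : ℕ),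
      ∑ n ∈ Finset.Ico j M, ‖∑ k ∈ Finset.range K, l (n + k) * a k‖ ^ 2 ≤
        C * (∑ m ∈ Finset.Ico j (M + K), ‖l m‖ ^ 2) *
          ∑ k ∈ Finset.range K, ((k : ℝ) + 1) * ‖a k‖ ^ 2 := by
  obtain ⟨C₁, hC₁⟩ := hE.exists_eLpNorm_le
  -- The exponent with `1 / p + 1 / s = 1 / 2`; the embedding is available for even integers, and
  -- the measure is a probability measure, so any even integer above `s` will do.
  set s : ℝ := 2 * p / (p - 2) with hs
  have hp2 : 0 < p - 2 := by linarith
  have hs0 : 0 < s := by positivity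
  obtain ⟨i, hi⟩ := exists_nat_ge s
  obtain ⟨C₂, hC₂0, hC₂⟩ := exists_eLpNorm_eval_toCircle_le 1 i
  have hsi : ENNReal.ofReal s ≤ ((2 * (i + 1) : ℕ) : ℝ≥0∞) := by
    rw [← ENNReal.ofReal_natCast]
    refine ENNReal.ofReal_le_ofReal ?_
    push_cast
    linarith [hs0]
  have hH : ENNReal.HolderTriple (ENNReal.ofReal p) (ENNReal.ofReal s) 2 := by
    refine ⟨?_⟩
    rw [← ENNReal.ofReal_inv_of_pos (by linarith), ← ENNReal.ofReal_inv_of_pos hs0,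
      ← ENNReal.ofReal_add (by positivity) (by positivity)]
    have : p⁻¹ + s⁻¹ = 2⁻¹ := by rw [hs]; field_simp; ring
    rw [this, ENNReal.ofReal_inv_of_pos two_pos]
    simp
  refine ⟨((C₁ : ℝ) * C₂) ^ 2, by positivity, fun l hl a j M K => ?_⟩
  -- `P` is the tail of the symbol and `Q` the reflection of `∑ a_k z^k`, shifted by `K` to have
  -- nonnegative exponents. On the circle `|Q| = |F|`, where `F` has the conjugate coefficients.
  set P : ℂ[X] := ∑ m ∈ Finset.Ico j (M + K), monomial m (l m) with hP
  set Q : ℂ[X] := ∑ k ∈ Finset.range K, monomial (K - k) (a k) with hQ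
  set F : ℂ[X] := ∑ k ∈ Finset.range K, monomial k (conj (a k)) with hF
  have hPc (m : ℕ) : P.coeff m = if m ∈ Finset.Ico j (M + K) then l m else 0 := by
    simp [hP, finsetSum_coeff, coeff_monomial]
  have hFc (m : ℕ) : F.coeff m = if m ∈ Finset.range K then conj (a m) else 0 := by
    simp [hF, finsetSum_coeff, coeff_monomial]
  have hPQ (n : ℕ) (hn : n ∈ Finset.Ico j M) :
      (P * Q).coeff (K + n) = ∑ k ∈ Finset.range K, l (n + k) * a k := by
    rw [hQ, Finset.mul_sum, finsetSum_coeff]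
    refine Finset.sum_congr rfl fun k hk => ?_
    rw [Finset.mem_range] at hk
    rw [Finset.mem_Ico] at hn
    have e : K + n = (n + k) + (K - k) := by omega
    rw [e, coeff_mul_monomial, hPc, if_pos (by rw [Finset.mem_Ico]; omega)]
  have hQF (t : UnitAddCircle) : ‖Q.eval (toCircle t : ℂ)‖ = ‖F.eval (toCircle t : ℂ)‖ := by
    set z : ℂ := (toCircle t : ℂ) with hz
    have hz1 : ‖z‖ = 1 := Circle.norm_coe _
    have hzz : z * conj z = 1 := by rw [Complex.mul_conj', hz1]; simp
    have : Q.eval z = z ^ K * conj (F.eval z) := by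
      simp only [hQ, hF, eval_finsetSum, eval_monomial, map_sum, map_mul, map_pow,
        Complex.conj_conj, Finset.mul_sum]
      refine Finset.sum_congr rfl fun k hk => ?_
      rw [Finset.mem_range] at hk
      have e : z ^ K = z ^ (K - k) * z ^ k := by rw [← pow_add]; congr 1; omega
      have e2 : z ^ k * conj z ^ k = 1 := by rw [← mul_pow, hzz, one_pow]
      rw [e]
      linear_combination (-(z ^ (K - k) * a k)) * e2
    rw [this, norm_mul, norm_pow, hz1, one_pow, one_mul, RCLike.norm_conj]
  have hD : (dirichletDensity F).eval 1 = ∑ k ∈ Finset.range K, ((k : ℝ) + 1) * ‖a k‖ ^ 2 := by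
    rw [dirichletDensity, eval_finsetSum]
    have hsub : F.support ⊆ Finset.range K := fun k hk => by
      by_contra h
      rw [mem_support_iff, hFc, if_neg h] at hk
      exact hk rfl
    simp only [eval_monomial, one_pow, mul_one]
    rw [Finset.sum_subset hsub fun k _ hk => by simp [notMem_support_iff.1 hk]]
    refine Finset.sum_congr rfl fun k hk => ?_
    rw [hFc, if_pos hk, RCLike.norm_conj]
  have hD0 : 0 ≤ ∑ k ∈ Finset.range K, ((k : ℝ) + 1) * ‖a k‖ ^ 2 := by positivity
  -- Hölder's inequality and the two norm bounds.
  have hmain : eLpNorm (fun t : UnitAddCircle => (P * Q).eval (toCircle t : ℂ)) 2 haarAddCircle ≤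
      (C₁ * eLpNorm (fun t : UnitAddCircle => P.eval (toCircle t : ℂ)) 2 haarAddCircle) *
        ENNReal.ofReal (C₂ * √(∑ k ∈ Finset.range K, ((k : ℝ) + 1) * ‖a k‖ ^ 2)) := by
    have h1 := eLpNorm_smul_le_mul_eLpNorm (μ := haarAddCircle (T := 1)) (r := 2)
      (p := ENNReal.ofReal p) (q := ENNReal.ofReal s)
      (continuous_eval_toCircle Q).aestronglyMeasurable
      (continuous_eval_toCircle P).aestronglyMeasurable
    have e : (fun t : UnitAddCircle => (P * Q).eval (toCircle t : ℂ)) =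
        (fun t : UnitAddCircle => P.eval (toCircle t : ℂ)) •
          fun t : UnitAddCircle => Q.eval (toCircle t : ℂ) := by
      funext t; simp
    rw [e]
    refine h1.trans (mul_le_mul' (hC₁ P fun n hn => ?_) ?_)
    · rw [hPc, hl n hn, ite_self]
    · rw [eLpNorm_congr_norm_ae (ae_of_all _ hQF), ← hD]
      exact (eLpNorm_le_eLpNorm_of_exponent_le hsi
        (continuous_eval_toCircle F).aestronglyMeasurable).trans (hC₂ F)
  have hfin : ∑ n ∈ Finset.Ico j M, ‖∑ k ∈ Finset.range K, l (n + k) * a k‖ₑ ^ 2 ≤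
      ENNReal.ofReal (((C₁ : ℝ) * C₂) ^ 2 * (∑ m ∈ Finset.Ico j (M + K), ‖l m‖ ^ 2) *
          ∑ k ∈ Finset.range K, ((k : ℝ) + 1) * ‖a k‖ ^ 2) := by
    calc _ = ∑ n ∈ Finset.Ico j M, ‖(P * Q).coeff (K + n)‖ₑ ^ 2 :=
          Finset.sum_congr rfl fun n hn => by rw [hPQ n hn]
      _ ≤ ∑' n, ‖(P * Q).coeff (K + n)‖ₑ ^ 2 := ENNReal.sum_le_tsum _
      _ ≤ ∑' n, ‖(P * Q).coeff n‖ₑ ^ 2 :=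
          ENNReal.tsum_comp_le_tsum_of_injective (add_right_injective K) _
      _ = eLpNorm (fun t : UnitAddCircle => (P * Q).eval (toCircle t : ℂ)) 2
            haarAddCircle ^ 2 := (eLpNorm_two_eval_toCircle_sq _).symm
      _ ≤ _ := pow_le_pow_left' hmain 2
      _ = _ := by
          rw [mul_pow, mul_pow, eLpNorm_two_eval_toCircle_sq,
            tsum_eq_sum (s := Finset.Ico j (M + K)) fun m hm => by rw [hPc, if_neg hm]; simp,
            ← ENNReal.ofReal_pow (by positivity), mul_pow, Real.sq_sqrt hD0]
          have e1 : ∑ m ∈ Finset.Ico j (M + K), ‖P.coeff m‖ₑ ^ 2 =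
              ENNReal.ofReal (∑ m ∈ Finset.Ico j (M + K), ‖l m‖ ^ 2) := by
            rw [ENNReal.ofReal_sum_of_nonneg fun _ _ => by positivity]
            refine Finset.sum_congr rfl fun m hm => ?_
            rw [hPc, if_pos hm, ENNReal.ofReal_pow (norm_nonneg _), ofReal_norm]
          have e2 : (C₁ : ℝ≥0∞) ^ 2 = ENNReal.ofReal ((C₁ : ℝ) ^ 2) := by
            rw [ENNReal.ofReal_pow C₁.coe_nonneg]; simp
          rw [e1, e2, ← ENNReal.ofReal_mul (by positivity), ← ENNReal.ofReal_mul (by positivity)]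
          congr 1
          ring
  rw [← ENNReal.ofReal_le_ofReal_iff (by positivity)]
  refine le_trans (le_of_eq ?_) hfin
  rw [ENNReal.ofReal_sum_of_nonneg fun _ _ => by positivity]
  exact Finset.sum_congr rfl fun n _ => by
    rw [ENNReal.ofReal_pow (norm_nonneg _), ofReal_norm]

/-- The weighted bound. As `n + 1` counts the `j ≤ n`, summing the unweighted bound for the
indices `n ≥ j` over all `j` produces the weights on both sides. -/
theorem IsLambdaSet.exists_sum_weighted_norm_sq_le {p : ℝ} (hp : 2 < p) {E : Set ℤ}
    (hE : IsLambdaSet p E) :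
    ∃ C : ℝ, 0 ≤ C ∧ ∀ l : ℕ → ℂ, (∀ n : ℕ, (n : ℤ) ∉ E → l n = 0) → ∀ (a : ℕ → ℂ) (N M K : ℕ),
      ∑ n ∈ Finset.Ico N M, ((n : ℝ) + 1) * ‖∑ k ∈ Finset.range K, l (n + k) * a k‖ ^ 2 ≤
        C * (∑ m ∈ Finset.Ico N (M + K), ((m : ℝ) + 1) * ‖l m‖ ^ 2) *
          ∑ k ∈ Finset.range K, ((k : ℝ) + 1) * ‖a k‖ ^ 2 := by
  obtain ⟨C, hC0, hC⟩ := hE.exists_sum_norm_sq_le hp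
  refine ⟨C, hC0, fun l hl a N M K => ?_⟩
  have hcount (x : ℕ → ℝ) (L : ℕ) :
      ∑ j ∈ Finset.range M, ∑ n ∈ Finset.Ico (max j N) L, x n =
        ∑ n ∈ Finset.Ico N L, (min M (n + 1) : ℕ) * x n := by
    have h1 (j : ℕ) : ∑ n ∈ Finset.Ico (max j N) L, x n =
        ∑ n ∈ Finset.Ico N L, if j ≤ n then x n else 0 := by
      rw [← Finset.sum_filter]
      congr 1
      ext n
      simp only [Finset.mem_Ico, Finset.mem_filter]
      omega
    simp_rw [h1]
    rw [Finset.sum_comm]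
    refine Finset.sum_congr rfl fun n _ => ?_
    rw [← Finset.sum_filter, Finset.sum_const, nsmul_eq_mul]
    congr 2
    have : {j ∈ Finset.range M | j ≤ n} = Finset.range (min M (n + 1)) := by
      ext j
      simp only [Finset.mem_filter, Finset.mem_range]
      omega
    rw [this, Finset.card_range]
  have hA : 0 ≤ ∑ k ∈ Finset.range K, ((k : ℝ) + 1) * ‖a k‖ ^ 2 := by positivity
  calc _ = ∑ n ∈ Finset.Ico N M,
        (min M (n + 1) : ℕ) * ‖∑ k ∈ Finset.range K, l (n + k) * a k‖ ^ 2 := by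
        refine Finset.sum_congr rfl fun n hn => ?_
        rw [Finset.mem_Ico] at hn
        rw [min_eq_right (by omega)]
        push_cast
        rfl
    _ = ∑ j ∈ Finset.range M, ∑ n ∈ Finset.Ico (max j N) M,
          ‖∑ k ∈ Finset.range K, l (n + k) * a k‖ ^ 2 := (hcount _ _).symm
    _ ≤ ∑ j ∈ Finset.range M, C * (∑ m ∈ Finset.Ico (max j N) (M + K), ‖l m‖ ^ 2) *
          ∑ k ∈ Finset.range K, ((k : ℝ) + 1) * ‖a k‖ ^ 2 :=
        Finset.sum_le_sum fun j _ => hC l hl a _ M K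
    _ = C * (∑ m ∈ Finset.Ico N (M + K), (min M (m + 1) : ℕ) * ‖l m‖ ^ 2) *
          ∑ k ∈ Finset.range K, ((k : ℝ) + 1) * ‖a k‖ ^ 2 := by
        rw [← Finset.sum_mul, ← Finset.mul_sum, hcount]
    _ ≤ _ := by
        gcongr with m hm
        exact_mod_cast min_le_right _ _

/-! ### Taylor coefficients and the area integral -/

theorem hasSum_taylorCoeff {f : ℂ → ℂ} (hf : DifferentiableOn ℂ f disk) {z : ℂ} (hz : z ∈ disk) :
    HasSum (fun k => taylorCoeff f k * z ^ k) (f z) := by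
  refine (Complex.hasSum_taylorSeries_on_ball hf hz).congr_fun fun k => ?_
  rw [taylorCoeff, smul_eq_mul, smul_eq_mul, sub_zero]
  ring

theorem hasFPowerSeriesOnBall_of_hasSum {b : ℕ → ℂ} {g : ℂ → ℂ}
    (h : ∀ z ∈ disk, HasSum (fun n => b n * z ^ n) (g z)) :
    HasFPowerSeriesOnBall g (FormalMultilinearSeries.ofScalars ℂ b) 0 1 where
  r_le := by
    refine ENNReal.le_of_forall_nnreal_lt fun r hr => ?_
    have hr1 : (r : ℝ) < 1 := by exact_mod_cast hr
    refine FormalMultilinearSeries.le_radius_of_summable _ ?_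
    have := (h (r : ℂ) (by simpa using hr1)).summable.norm
    refine this.congr fun n => ?_
    rw [FormalMultilinearSeries.ofScalars_norm]
    simp
  r_pos := one_pos
  hasSum := fun {y} hy => by
    have hy' : y ∈ disk := by
      simpa [edist_zero_right, ← ofReal_norm, ENNReal.ofReal_lt_one] using hy
    simpa [FormalMultilinearSeries.ofScalars_apply_eq, mul_comm] using h y hy'

theorem differentiableOn_of_hasSum {b : ℕ → ℂ} {g : ℂ → ℂ}
    (h : ∀ z ∈ disk, HasSum (fun n => b n * z ^ n) (g z)) : DifferentiableOn ℂ g disk := by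
  have := (hasFPowerSeriesOnBall_of_hasSum h).differentiableOn
  rwa [← ENNReal.ofReal_one, Metric.eball_ofReal] at this

theorem taylorCoeff_eq_of_hasSum {b : ℕ → ℂ} {g : ℂ → ℂ}
    (h : ∀ z ∈ disk, HasSum (fun n => b n * z ^ n) (g z)) (n : ℕ) : taylorCoeff g n = b n := by
  have := (hasFPowerSeriesOnBall_of_hasSum h).factorial_smul 1 n
  rw [iteratedFDeriv_apply_eq_iteratedDeriv_mul_prod, Finset.prod_const_one, one_smul] at this
  rw [taylorCoeff, ← this]
  have h0 : (n.factorial : ℂ) ≠ 0 := by exact_mod_cast n.factorial_ne_zero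
  simp [h0]

theorem taylorCoeff_deriv (f : ℂ → ℂ) (k : ℕ) :
    taylorCoeff (deriv f) k = ((k : ℂ) + 1) * taylorCoeff f (k + 1) := by
  have h0 : (k.factorial : ℂ) ≠ 0 := by exact_mod_cast k.factorial_ne_zero
  have h1 : (k : ℂ) + 1 ≠ 0 := by exact_mod_cast k.succ_ne_zero
  rw [taylorCoeff, taylorCoeff, iteratedDeriv_succ', Nat.factorial_succ]
  push_cast
  field_simp

/-- Integration over an angle, in terms of the normalized measure of the circle of length `2π`. -/
theorem setLIntegral_Ioo_pi_eq [Fact (0 < 2 * Real.pi)] (F : ℂ → ℝ≥0∞) :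
    ∫⁻ θ in Set.Ioo (-Real.pi) Real.pi, F (Real.cos θ + Real.sin θ * Complex.I) =
      ENNReal.ofReal (2 * Real.pi) *
        ∫⁻ t : AddCircle (2 * Real.pi), F (toCircle t : ℂ) ∂haarAddCircle := by
  have h := AddCircle.lintegral_preimage (2 * Real.pi) (-Real.pi)
    fun t => F (toCircle t : ℂ)
  rw [volume_eq_smul_haarAddCircle, lintegral_smul_measure, smul_eq_mul] at h
  rw [← h, show -Real.pi + 2 * Real.pi = Real.pi by ring, setLIntegral_congr Ioo_ae_eq_Ioc]
  refine lintegral_congr fun θ => ?_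
  rw [toCircle_apply_mk, div_self Real.two_pi_pos.ne', one_mul, Circle.coe_exp, Complex.exp_mul_I]
  simp

/-- The area integral of `|g|²` in terms of the Taylor coefficients of `g`: integrate Parseval's
identity on the circles of radius `r < 1`. -/
theorem lintegral_enorm_sq_diskMeasure {g : ℂ → ℂ} (hg : DifferentiableOn ℂ g disk) :
    ∫⁻ z, ‖g z‖ₑ ^ 2 ∂diskMeasure =
      ∑' k : ℕ, ENNReal.ofReal (‖taylorCoeff g k‖ ^ 2 / (k + 1)) := by
  classical
  have : Fact (0 < 2 * Real.pi) := ⟨Real.two_pi_pos⟩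
  set F : ℂ → ℝ≥0∞ := disk.indicator fun z => ‖g z‖ₑ ^ 2 with hF
  have hFm : Measurable F := by
    rw [hF, ← Set.piecewise_eq_indicator]
    refine ContinuousOn.measurable_piecewise ?_ continuousOn_const measurableSet_ball
    exact (ENNReal.continuous_pow 2).comp_continuousOn hg.continuousOn.enorm
  have hangle (r : ℝ) (hr : 0 < r) :
      ∫⁻ θ in Set.Ioo (-Real.pi) Real.pi, F (r * (Real.cos θ + Real.sin θ * Complex.I)) =
        (Set.Ioo (0 : ℝ) 1).indicator (fun r => ENNReal.ofReal (2 * Real.pi) *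
          ∑' k : ℕ, ENNReal.ofReal (‖taylorCoeff g k‖ ^ 2 * r ^ (2 * k))) r := by
    rw [setLIntegral_Ioo_pi_eq fun z => F (r * z)]
    have hn (t : AddCircle (2 * Real.pi)) : ‖(r : ℂ) * toCircle t‖ = r := by
      rw [norm_mul, Circle.norm_coe, mul_one, Complex.norm_real, Real.norm_of_nonneg hr.le]
    by_cases hr1 : r < 1
    · rw [Set.indicator_of_mem (Set.mem_Ioo.2 ⟨hr, hr1⟩)]
      congr 1
      have hsum : Summable fun k => ‖taylorCoeff g k * (r : ℂ) ^ k‖ :=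
        (hasSum_taylorCoeff hg (z := r) (by simpa [abs_of_pos hr] using hr1)).summable.norm
      calc _ = ∫⁻ t : AddCircle (2 * Real.pi),
            ‖∑' k, taylorCoeff g k * (r : ℂ) ^ k * (toCircle t : ℂ) ^ k‖ₑ ^ 2 ∂haarAddCircle := by
            refine lintegral_congr fun t => ?_
            have hd : (r : ℂ) * toCircle t ∈ disk := by
              rw [mem_ball_zero_iff, hn]; exact hr1
            rw [hF, Set.indicator_of_mem hd, ← (hasSum_taylorCoeff hg hd).tsum_eq]
            simp_rw [mul_pow, mul_assoc]
        _ = ∑' k, ‖taylorCoeff g k * (r : ℂ) ^ k‖ₑ ^ 2 :=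
            lintegral_enorm_sq_tsum_mul_toCircle_pow hsum
        _ = _ := by
            refine tsum_congr fun k => ?_
            rw [← ofReal_norm, ← ENNReal.ofReal_pow (norm_nonneg _), norm_mul, norm_pow,
              Complex.norm_real, Real.norm_of_nonneg hr.le, mul_pow, ← pow_mul, mul_comm k]
    · rw [Set.indicator_of_notMem (fun h => hr1 h.2)]
      have h0 (t : AddCircle (2 * Real.pi)) : F ((r : ℂ) * toCircle t) = 0 := by
        refine Set.indicator_of_notMem ?_ _
        rw [mem_ball_zero_iff, hn]
        exact hr1
      simp [h0]
  have hradial (k : ℕ) : ∫⁻ r in Set.Ioo (0 : ℝ) 1, ENNReal.ofReal (r * (‖taylorCoeff g k‖ ^ 2 *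
      r ^ (2 * k))) = ENNReal.ofReal (‖taylorCoeff g k‖ ^ 2 / (2 * (k + 1))) := by
    have e (r : ℝ) : r * (‖taylorCoeff g k‖ ^ 2 * r ^ (2 * k)) =
        ‖taylorCoeff g k‖ ^ 2 * r ^ (2 * k + 1) := by ring
    simp_rw [e]
    rw [← ofReal_integral_eq_lintegral_ofReal]
    · congr 1
      rw [← integral_Ioc_eq_integral_Ioo, ← intervalIntegral.integral_of_le zero_le_one,
        intervalIntegral.integral_const_mul, integral_pow]
      push_cast
      field_simp
      simp
      ring
    · refine Continuous.integrableOn_Icc (by fun_prop) |>.mono_set Set.Ioo_subset_Icc_self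
    · filter_upwards [ae_restrict_mem measurableSet_Ioo] with r hr
      have := hr.1
      simp only [Pi.zero_apply]
      positivity
  have hpolar : ∫⁻ z, F z = ENNReal.ofReal Real.pi *
      ∑' k : ℕ, ENNReal.ofReal (‖taylorCoeff g k‖ ^ 2 / (k + 1)) := by
    have hmeas : Measurable fun p : ℝ × ℝ =>
        ENNReal.ofReal p.1 * F (p.1 * (Real.cos p.2 + Real.sin p.2 * Complex.I)) :=
      (ENNReal.measurable_ofReal.comp measurable_fst).mul (hFm.comp (by fun_prop))
    rw [← Complex.lintegral_comp_polarCoord_symm]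
    simp_rw [Complex.polarCoord_symm_apply, smul_eq_mul]
    rw [polarCoord_target, Measure.volume_eq_prod, ← Measure.prod_restrict,
      lintegral_prod _ hmeas.aemeasurable]
    calc _ = ∫⁻ r in Set.Ioi (0 : ℝ), (Set.Ioo (0 : ℝ) 1).indicator (fun r => ∑' k : ℕ,
          ENNReal.ofReal (2 * Real.pi) *
            ENNReal.ofReal (r * (‖taylorCoeff g k‖ ^ 2 * r ^ (2 * k)))) r := by
          refine setLIntegral_congr_fun measurableSet_Ioi fun r hr => ?_
          simp only
          rw [lintegral_const_mul' _ _ ENNReal.ofReal_ne_top, hangle r hr]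
          by_cases h : r ∈ Set.Ioo (0 : ℝ) 1
          · rw [Set.indicator_of_mem h, Set.indicator_of_mem h, ← ENNReal.tsum_mul_left,
              ← ENNReal.tsum_mul_left]
            refine tsum_congr fun k => ?_
            rw [ENNReal.ofReal_mul (le_of_lt hr)]
            ring
          · rw [Set.indicator_of_notMem h, Set.indicator_of_notMem h, mul_zero]
      _ = ∫⁻ r in Set.Ioo (0 : ℝ) 1, ∑' k : ℕ, ENNReal.ofReal (2 * Real.pi) *
            ENNReal.ofReal (r * (‖taylorCoeff g k‖ ^ 2 * r ^ (2 * k))) := by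
          rw [setLIntegral_indicator measurableSet_Ioo,
            Set.inter_eq_left.2 Set.Ioo_subset_Ioi_self]
      _ = _ := by
          rw [lintegral_tsum fun k => by fun_prop, ← ENNReal.tsum_mul_left]
          refine tsum_congr fun k => ?_
          rw [lintegral_const_mul' _ _ ENNReal.ofReal_ne_top, hradial,
            ← ENNReal.ofReal_mul (by positivity), ← ENNReal.ofReal_mul (by positivity)]
          congr 1
          field_simp
  rw [diskMeasure, lintegral_smul_measure, ← lintegral_indicator measurableSet_ball, hpolar,
    smul_eq_mul, ← mul_assoc, ← ENNReal.ofReal_mul (by positivity),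
    inv_mul_cancel₀ Real.pi_ne_zero, ENNReal.ofReal_one, one_mul]

theorem lintegral_enorm_sq_deriv_diskMeasure {f : ℂ → ℂ} (hf : DifferentiableOn ℂ f disk) :
    ∫⁻ z, ‖deriv f z‖ₑ ^ 2 ∂diskMeasure =
      ∑' k : ℕ, ENNReal.ofReal (((k : ℝ) + 1) * ‖taylorCoeff f (k + 1)‖ ^ 2) := by
  rw [lintegral_enorm_sq_diskMeasure (hf.deriv Metric.isOpen_ball)]
  refine tsum_congr fun k => ?_
  congr 1
  have : ‖(k : ℂ) + 1‖ = (k : ℝ) + 1 := by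
    exact_mod_cast Complex.norm_natCast (k + 1)
  rw [taylorCoeff_deriv, norm_mul, this]
  field_simp

/-! ### The Dirichlet space as a weighted `ℓ²` space -/

/-- The weight of the `k`-th Taylor coefficient in the norm of the Dirichlet space: `1` for `k = 0`
and `k` otherwise. -/
def weight (k : ℕ) : ℝ := max 1 k

theorem weight_zero : weight 0 = 1 := by simp [weight]

theorem weight_succ (k : ℕ) : weight (k + 1) = k + 1 := by
  simp [weight]

theorem weight_pos (k : ℕ) : 0 < weight k := by simp [weight]

theorem weight_le (k : ℕ) : weight k ≤ k + 1 := by simp [weight]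

theorem le_two_mul_weight (k : ℕ) : (k : ℝ) + 1 ≤ 2 * weight k := by
  have h1 : (1 : ℝ) ≤ weight k := le_max_left _ _
  have h2 : (k : ℝ) ≤ weight k := le_max_right _ _
  linarith

theorem summable_weight_mul_iff {x : ℕ → ℝ} (hx : ∀ k, 0 ≤ x k) :
    (Summable fun k => weight k * x k) ↔ Summable fun k : ℕ => ((k : ℝ) + 1) * x k := by
  refine ⟨fun h => ?_, fun h => ?_⟩
  · refine .of_nonneg_of_le (fun k => by have := hx k; positivity) (fun k => ?_) (h.mul_left 2)
    rw [← mul_assoc]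
    exact mul_le_mul_of_nonneg_right (le_two_mul_weight k) (hx k)
  · exact .of_nonneg_of_le (fun k => mul_nonneg (weight_pos k).le (hx k))
      (fun k => mul_le_mul_of_nonneg_right (weight_le k) (hx k)) h

namespace DirichletSpace

/-- The norm of the Dirichlet space in terms of the Taylor coefficients. -/
theorem hasSum_weight_mul_norm_taylorCoeff_sq (f : DirichletSpace) :
    HasSum (fun k => weight k * ‖taylorCoeff f k‖ ^ 2) (‖f‖ ^ 2) := by
  have hint := (f.memLp_deriv.integrable_norm_pow (by norm_num))
  have hfin : ∫⁻ z, ‖deriv f z‖ₑ ^ 2 ∂diskMeasure ≠ ∞ := by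
    have := hint.2.ne
    simpa [hasFiniteIntegral_iff_enorm] using this
  have hI : ∫ z, ‖deriv f z‖ ^ 2 ∂diskMeasure =
      (∫⁻ z, ‖deriv f z‖ₑ ^ 2 ∂diskMeasure).toReal := by
    rw [integral_eq_lintegral_of_nonneg_ae (ae_of_all _ fun _ => by positivity)
      hint.aestronglyMeasurable]
    simp_rw [ENNReal.ofReal_pow (norm_nonneg _), ofReal_norm]
  have h0 : f 0 = taylorCoeff f 0 := by simp [taylorCoeff]
  rw [norm_sq, hI, lintegral_enorm_sq_deriv_diskMeasure f.2.1, h0]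
  rw [lintegral_enorm_sq_deriv_diskMeasure f.2.1] at hfin
  have hs := ENNReal.hasSum_toReal hfin
  refine (hasSum_nat_add_iff' 1).1 ?_
  rw [Finset.sum_range_one, weight_zero, one_mul, add_sub_cancel_left]
  rw [ENNReal.tsum_toReal_eq fun k => ENNReal.ofReal_ne_top]
  refine hs.congr_fun fun k => ?_
  rw [ENNReal.toReal_ofReal (by positivity), weight_succ]

theorem hasSum_taylorCoeff (f : DirichletSpace) {z : ℂ} (hz : z ∈ disk) :
    HasSum (fun k => taylorCoeff f k * z ^ k) (f z) :=
  DirichletHankel.hasSum_taylorCoeff f.2.1 hz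

theorem taylorCoeff_add (f g : DirichletSpace) (k : ℕ) :
    taylorCoeff (f + g : DirichletSpace) k = taylorCoeff f k + taylorCoeff g k :=
  taylorCoeff_eq_of_hasSum (b := fun k => taylorCoeff f k + taylorCoeff g k)
    (fun _ hz => ((f.hasSum_taylorCoeff hz).add (g.hasSum_taylorCoeff hz)).congr_fun
      fun _ => add_mul _ _ _) k

theorem taylorCoeff_smul (c : ℂ) (f : DirichletSpace) (k : ℕ) :
    taylorCoeff (c • f : DirichletSpace) k = c * taylorCoeff f k :=
  taylorCoeff_eq_of_hasSum (b := fun k => c * taylorCoeff f k)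
    (fun _ hz => ((f.hasSum_taylorCoeff hz).mul_left c).congr_fun fun _ => mul_assoc _ _ _) k

theorem ext_of_eqOn {f g : DirichletSpace} (h : ∀ z ∈ disk, f z = g z) : f = g := by
  refine Subtype.ext (funext fun z => ?_)
  by_cases hz : z ∈ disk
  · exact h z hz
  · exact (f.2.2.2 z hz).trans (g.2.2.2 z hz).symm

/-- A sequence with `∑ (k + 1) |b_k|² < ∞` is the sequence of Taylor coefficients of a function of
the Dirichlet space. -/
theorem exists_hasSum {b : ℕ → ℂ} (hb : Summable fun k : ℕ => ((k : ℝ) + 1) * ‖b k‖ ^ 2) :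
    ∃ f : DirichletSpace, ∀ z ∈ disk, HasSum (fun k => b k * z ^ k) (f z) := by
  have hb2 : Summable fun k => ‖b k‖ ^ 2 :=
    .of_nonneg_of_le (fun k => by positivity)
      (fun k => le_mul_of_one_le_left (by positivity) (by simp)) hb
  have hsum : ∀ z ∈ disk, HasSum (fun k => b k * z ^ k)
      (disk.indicator (fun z => ∑' k, b k * z ^ k) z) := by
    intro z hz
    rw [Set.indicator_of_mem hz]
    refine Summable.hasSum (.of_norm ?_)
    have hz1 : ‖z‖ < 1 := by simpa using hz
    have hg : Summable fun k => (‖z‖ ^ 2) ^ k :=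
      summable_geometric_of_lt_one (by positivity) (by nlinarith [norm_nonneg z])
    refine .of_nonneg_of_le (fun k => norm_nonneg _) (fun k => ?_) (hb2.add hg)
    rw [norm_mul, norm_pow, ← pow_mul, mul_comm 2, pow_mul]
    nlinarith [sq_nonneg (‖b k‖ - ‖z‖ ^ k), sq_nonneg ‖b k‖, sq_nonneg (‖z‖ ^ k)]
  have hd := differentiableOn_of_hasSum hsum
  refine ⟨⟨_, hd, ⟨?_, ?_⟩, fun z hz => Set.indicator_of_notMem hz _⟩, hsum⟩
  · exact (measurable_deriv _).aestronglyMeasurable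
  · have h1 := lintegral_enorm_sq_deriv_diskMeasure hd
    simp_rw [taylorCoeff_eq_of_hasSum hsum] at h1
    have h2 : Summable fun k : ℕ => ((k : ℝ) + 1) * ‖b (k + 1)‖ ^ 2 := by
      refine .of_nonneg_of_le (fun k => by positivity) (fun k => ?_) ((summable_nat_add_iff 1).2 hb)
      push_cast
      gcongr
      linarith
    rw [← ENNReal.ofReal_tsum_of_nonneg (fun k => by positivity) h2] at h1
    have h3 := (eLpNorm_natCast_pow two_ne_zero _).trans h1
    rw [lt_top_iff_ne_top]
    intro h4
    rw [Nat.cast_ofNat, h4, ENNReal.top_pow two_ne_zero] at h3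
    exact ENNReal.ofReal_ne_top h3.symm

theorem hasSum_norm_sqrt_weight_mul_rpow (f : DirichletSpace) :
    HasSum (fun k => ‖(√(weight k) : ℂ) * taylorCoeff f k‖ ^ (2 : ℝ≥0∞).toReal) (‖f‖ ^ 2) := by
  refine f.hasSum_weight_mul_norm_taylorCoeff_sq.congr_fun fun k => ?_
  rw [ENNReal.toReal_ofNat, Real.rpow_two, norm_mul, mul_pow, Complex.norm_real,
    Real.norm_of_nonneg (Real.sqrt_nonneg _), Real.sq_sqrt (weight_pos k).le]

/-- The weighted Taylor coefficients, as a linear isometry to `ℓ²`. -/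
def toLp : DirichletSpace →ₗᵢ[ℂ] lp (fun _ : ℕ => ℂ) 2 where
  toFun f := ⟨fun k => (√(weight k) : ℂ) * taylorCoeff f k,
    memℓp_gen f.hasSum_norm_sqrt_weight_mul_rpow.summable⟩
  map_add' f g := by
    ext k
    exact (congrArg _ (taylorCoeff_add f g k)).trans (mul_add _ _ _)
  map_smul' c f := by
    ext k
    exact (congrArg _ (taylorCoeff_smul c f k)).trans (mul_left_comm _ _ _)
  norm_map' f := by
    refine (pow_left_inj₀ (norm_nonneg _) (norm_nonneg _) two_ne_zero).1 ?_
    have h := (lp.hasSum_norm (p := 2) (by simp)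
      (⟨fun k => (√(weight k) : ℂ) * taylorCoeff f k,
        memℓp_gen f.hasSum_norm_sqrt_weight_mul_rpow.summable⟩ : lp (fun _ : ℕ => ℂ) 2)).unique
      f.hasSum_norm_sqrt_weight_mul_rpow
    exact ((Real.rpow_two _).symm.trans
      (congrArg _ (ENNReal.toReal_ofNat 2).symm)).trans h

theorem toLp_surjective : Function.Surjective toLp := by
  intro x
  have hx : Summable fun k => ‖x k‖ ^ 2 := by
    simpa using (lp.hasSum_norm (p := 2) (by simp) x).summable
  have hs (k : ℕ) : (√(weight k) : ℂ) ≠ 0 := by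
    exact_mod_cast (Real.sqrt_pos.2 (weight_pos k)).ne'
  obtain ⟨f, hf⟩ := exists_hasSum (b := fun k => x k / √(weight k)) <|
    (summable_weight_mul_iff fun k => by positivity).1 <| hx.congr fun k => by
      rw [norm_div, div_pow, Complex.norm_real, Real.norm_of_nonneg (Real.sqrt_nonneg _),
        Real.sq_sqrt (weight_pos k).le, mul_div_cancel₀ _ (weight_pos k).ne']
  refine ⟨f, ?_⟩
  ext k
  change (√(weight k) : ℂ) * taylorCoeff f k = x k
  rw [taylorCoeff_eq_of_hasSum hf, mul_div_cancel₀ _ (hs k)]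

instance : CompleteSpace DirichletSpace :=
  (LinearIsometryEquiv.ofSurjective toLp toLp_surjective).toIsometryEquiv.completeSpace

theorem ext_taylorCoeff {f g : DirichletSpace} (h : ∀ k, taylorCoeff f k = taylorCoeff g k) :
    f = g :=
  ext_of_eqOn fun _ hz => (f.hasSum_taylorCoeff hz).unique <|
    (g.hasSum_taylorCoeff hz).congr_fun fun k => by rw [h]

theorem norm_taylorCoeff_le (f : DirichletSpace) (k : ℕ) : ‖taylorCoeff f k‖ ≤ ‖f‖ := by
  refine (pow_le_pow_iff_left₀ (norm_nonneg _) (norm_nonneg _) two_ne_zero).1 ?_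
  have h := le_hasSum f.hasSum_weight_mul_norm_taylorCoeff_sq k fun i _ =>
    mul_nonneg (weight_pos i).le (by positivity)
  exact (le_mul_of_one_le_left (by positivity) (le_max_left _ _)).trans h

/-- The `k`-th Taylor coefficient as a continuous linear functional. -/
def taylorCoeffCLM (k : ℕ) : DirichletSpace →L[ℂ] ℂ :=
  LinearMap.mkContinuous
    { toFun := fun f => taylorCoeff f k
      map_add' := fun f g => taylorCoeff_add f g k
      map_smul' := fun c f => taylorCoeff_smul c f k } 1
    fun f => by simpa using f.norm_taylorCoeff_le k

theorem taylorCoeffCLM_apply (k : ℕ) (f : DirichletSpace) :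
    taylorCoeffCLM k f = taylorCoeff f k := rfl

theorem exists_monomial (n : ℕ) : ∃ e : DirichletSpace, ∀ k,
    taylorCoeff e k = if k = n then 1 else 0 := by
  obtain ⟨e, he⟩ := exists_hasSum (b := fun k => if k = n then 1 else 0)
    (summable_of_ne_finset_zero (s := {n}) fun k hk => by
      rw [if_neg (by simpa using hk)]; simp)
  exact ⟨e, taylorCoeff_eq_of_hasSum he⟩

/-- The monomial `z ^ n` in the Dirichlet space. -/
def monomial (n : ℕ) : DirichletSpace := (exists_monomial n).choose

theorem taylorCoeff_monomial (n k : ℕ) : taylorCoeff (monomial n) k = if k = n then 1 else 0 :=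
  (exists_monomial n).choose_spec k

/-- The projection that keeps the Taylor coefficients of index less than `N`. -/
def truncation (N : ℕ) : DirichletSpace →L[ℂ] DirichletSpace :=
  ∑ n ∈ Finset.range N, (taylorCoeffCLM n).smulRight (monomial n)

theorem taylorCoeff_truncation (N : ℕ) (f : DirichletSpace) (k : ℕ) :
    taylorCoeff (truncation N f) k = if k < N then taylorCoeff f k else 0 := by
  rw [← taylorCoeffCLM_apply, truncation, _root_.sum_apply, map_sum]
  simp only [ContinuousLinearMap.smulRight_apply, map_smul, taylorCoeffCLM_apply,
    taylorCoeff_monomial, smul_eq_mul, mul_ite, mul_one, mul_zero]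
  simp

theorem isCompactOperator_truncation (N : ℕ) : IsCompactOperator (truncation N) := by
  change truncation N ∈ compactOperator (RingHom.id ℂ) DirichletSpace DirichletSpace
  refine Submodule.sum_mem _ fun n _ => ?_
  exact (isCompactOperator_of_locallyCompactSpace_dom (taylorCoeffCLM n)).clm_comp
    (ContinuousLinearMap.toSpanSingleton ℂ (monomial n))

end DirichletSpace

/-! ### The Hankel type operator -/

namespace IsHankelOperator

variable {l : ℕ → ℂ} {T : DirichletSpace → DirichletSpace}

theorem tendsto_taylorCoeff (hT : IsHankelOperator l T) (f : DirichletSpace) (n : ℕ) :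
    Tendsto (fun N => ∑ k ∈ Finset.range N, l (n + k) * taylorCoeff f k) atTop
      (𝓝 (taylorCoeff (T f) n)) := by
  obtain ⟨b, hb, hs⟩ := hT f
  rw [taylorCoeff_eq_of_hasSum hs]
  exact hb n

/-- A Hankel type operator as a linear map. -/
def toLinearMap (hT : IsHankelOperator l T) : DirichletSpace →ₗ[ℂ] DirichletSpace where
  toFun := T
  map_add' f g := DirichletSpace.ext_taylorCoeff fun n => by
    rw [DirichletSpace.taylorCoeff_add]
    refine tendsto_nhds_unique (hT.tendsto_taylorCoeff _ n) ?_
    refine ((hT.tendsto_taylorCoeff f n).add (hT.tendsto_taylorCoeff g n)).congr fun N => ?_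
    rw [← Finset.sum_add_distrib]
    exact Finset.sum_congr rfl fun k _ => by rw [DirichletSpace.taylorCoeff_add, mul_add]
  map_smul' c f := DirichletSpace.ext_taylorCoeff fun n => by
    rw [RingHom.id_apply, DirichletSpace.taylorCoeff_smul]
    refine tendsto_nhds_unique (hT.tendsto_taylorCoeff _ n) ?_
    refine ((hT.tendsto_taylorCoeff f n).const_mul c).congr fun N => ?_
    rw [Finset.mul_sum]
    exact Finset.sum_congr rfl fun k _ => by rw [DirichletSpace.taylorCoeff_smul, mul_left_comm]

/-- The image of the constant function `1` has the coefficients `l n`. -/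
theorem taylorCoeff_map_one (hT : IsHankelOperator l T) (n : ℕ) :
    taylorCoeff (T (DirichletSpace.monomial 0)) n = l n := by
  refine tendsto_nhds_unique (hT.tendsto_taylorCoeff _ n) ?_
  refine tendsto_const_nhds.congr' ?_
  filter_upwards [eventually_gt_atTop 0] with N hN
  simp [DirichletSpace.taylorCoeff_monomial, hN.ne']

end IsHankelOperator

theorem HankelCompact.hankelBounded {l : ℕ → ℂ} (h : HankelCompact l) : HankelBounded l := by
  obtain ⟨T, hT, hc⟩ := h
  have hcont : Continuous hT.toLinearMap :=
    IsCompactOperator.continuous (f := hT.toLinearMap) hc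
  obtain ⟨C, hC0, hC⟩ := (⟨hT.toLinearMap, hcont⟩ : DirichletSpace →L[ℂ] DirichletSpace).bound
  exact ⟨T, hT, C, hC0, hC⟩

theorem HankelBounded.summable {l : ℕ → ℂ} (h : HankelBounded l) :
    Summable fun n : ℕ => ((n : ℝ) + 1) * ‖l n‖ ^ 2 := by
  obtain ⟨T, hT, -⟩ := h
  refine (summable_weight_mul_iff fun k => by positivity).1 ?_
  refine (T (DirichletSpace.monomial 0)).hasSum_weight_mul_norm_taylorCoeff_sq.summable.congr
    fun n => ?_
  rw [hT.taylorCoeff_map_one]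

theorem symbolInDirichlet_iff {l : ℕ → ℂ} :
    SymbolInDirichlet l ↔ Summable fun n : ℕ => ((n : ℝ) + 1) * ‖l n‖ ^ 2 := by
  refine ⟨fun ⟨h, hh⟩ => ?_, fun h => DirichletSpace.exists_hasSum (by simpa using h)⟩
  refine (summable_weight_mul_iff fun k => by positivity).1 ?_
  refine h.hasSum_weight_mul_norm_taylorCoeff_sq.summable.congr fun n => ?_
  rw [taylorCoeff_eq_of_hasSum hh, RCLike.norm_conj]

/-! ### Boundedness and compactness -/

section Tail

variable {l : ℕ → ℂ}

theorem summable_norm_sq_of_weighted {b : ℕ → ℂ}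
    (hb : Summable fun n : ℕ => ((n : ℝ) + 1) * ‖b n‖ ^ 2) : Summable fun n => ‖b n‖ ^ 2 :=
  .of_nonneg_of_le (fun k => by positivity)
      (fun k => le_mul_of_one_le_left (by positivity) (by simp)) hb

theorem DirichletSpace.summable_norm_taylorCoeff_sq (f : DirichletSpace) :
    Summable fun k : ℕ => ((k : ℝ) + 1) * ‖taylorCoeff f k‖ ^ 2 :=
  (summable_weight_mul_iff fun k => by positivity).1
    f.hasSum_weight_mul_norm_taylorCoeff_sq.summable

theorem DirichletSpace.tsum_norm_taylorCoeff_sq_le (f : DirichletSpace) :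
    ∑' k : ℕ, ((k : ℝ) + 1) * ‖taylorCoeff f k‖ ^ 2 ≤ 2 * ‖f‖ ^ 2 := by
  rw [← f.hasSum_weight_mul_norm_taylorCoeff_sq.tsum_eq, ← tsum_mul_left]
  refine f.summable_norm_taylorCoeff_sq.tsum_le_tsum (fun k => ?_)
    (f.hasSum_weight_mul_norm_taylorCoeff_sq.summable.mul_left 2)
  rw [← mul_assoc]
  exact mul_le_mul_of_nonneg_right (le_two_mul_weight k) (by positivity)

/-- The passage to the limit in the weighted bound for finite sums. The same constant serves for
all `N`, and only the tail of the symbol from `N` on enters. -/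
theorem IsLambdaSet.exists_sum_hankel_le {p : ℝ} (hp : 2 < p) {E : Set ℤ}
    (hE : IsLambdaSet p E) (hl : ∀ n : ℕ, (n : ℤ) ∉ E → l n = 0)
    (hs : Summable fun n : ℕ => ((n : ℝ) + 1) * ‖l n‖ ^ 2) :
    ∃ C : ℝ, 0 ≤ C ∧ ∀ (f : DirichletSpace) (b : ℕ → ℂ),
      (∀ n, Tendsto (fun K => ∑ k ∈ Finset.range K, l (n + k) * taylorCoeff f k) atTop
        (𝓝 (b n))) → ∀ N M : ℕ,
      ∑ n ∈ Finset.Ico N M, ((n : ℝ) + 1) * ‖b n‖ ^ 2 ≤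
        C * (∑' m : ℕ, (((m + N : ℕ) : ℝ) + 1) * ‖l (m + N)‖ ^ 2) * ‖f‖ ^ 2 := by
  obtain ⟨C, hC0, hC⟩ := hE.exists_sum_weighted_norm_sq_le hp
  refine ⟨2 * C, by positivity, fun f b hb N M => ?_⟩
  refine le_of_tendsto (tendsto_finsetSum _ fun n _ =>
    (((hb n).norm.pow 2).const_mul ((n : ℝ) + 1))) (Eventually.of_forall fun K => ?_)
  refine (hC l hl (fun k => taylorCoeff f k) N M K).trans ?_
  have h1 : ∑ m ∈ Finset.Ico N (M + K), ((m : ℝ) + 1) * ‖l m‖ ^ 2 ≤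
      ∑' m : ℕ, (((m + N : ℕ) : ℝ) + 1) * ‖l (m + N)‖ ^ 2 := by
    rw [Finset.sum_Ico_eq_sum_range]
    simp_rw [add_comm N]
    exact ((summable_nat_add_iff N).2 hs).sum_le_tsum _ fun _ _ => by positivity
  have h2 : ∑ k ∈ Finset.range K, ((k : ℝ) + 1) * ‖taylorCoeff f k‖ ^ 2 ≤ 2 * ‖f‖ ^ 2 :=
    (f.summable_norm_taylorCoeff_sq.sum_le_tsum _ fun _ _ => by positivity).trans
      f.tsum_norm_taylorCoeff_sq_le
  calc _ ≤ C * (∑' m : ℕ, (((m + N : ℕ) : ℝ) + 1) * ‖l (m + N)‖ ^ 2) * (2 * ‖f‖ ^ 2) := by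
        gcongr
    _ = _ := by ring

/-- Under the weighted square summability of the symbol, the Hankel operator exists. Its
truncations converge to it in operator norm, so it is compact. -/
theorem IsLambdaSet.hankelCompact {p : ℝ} (hp : 2 < p) {E : Set ℤ}
    (hE : IsLambdaSet p E) (hl : ∀ n : ℕ, (n : ℤ) ∉ E → l n = 0)
    (hs : Summable fun n : ℕ => ((n : ℝ) + 1) * ‖l n‖ ^ 2) : HankelCompact l := by
  obtain ⟨C, hC0, hC⟩ := hE.exists_sum_hankel_le hp hl hs
  set S : ℕ → ℝ := fun N => ∑' m : ℕ, (((m + N : ℕ) : ℝ) + 1) * ‖l (m + N)‖ ^ 2 with hS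
  have hS0 (N : ℕ) : 0 ≤ S N := tsum_nonneg fun m => by positivity
  have hconv (f : DirichletSpace) (n : ℕ) : Summable fun k => l (n + k) * taylorCoeff f k := by
    have h1 : Summable fun k => ‖l (n + k)‖ ^ 2 := by
      simpa only [add_comm n] using
        (summable_nat_add_iff n).2 (summable_norm_sq_of_weighted hs)
    have h2 := summable_norm_sq_of_weighted f.summable_norm_taylorCoeff_sq
    refine .of_norm (.of_nonneg_of_le (fun k => norm_nonneg _) (fun k => ?_) (h1.add h2))
    rw [norm_mul]
    nlinarith [sq_nonneg (‖l (n + k)‖ - ‖taylorCoeff f k‖), sq_nonneg ‖l (n + k)‖,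
      sq_nonneg ‖taylorCoeff f k‖]
  have hlim (f : DirichletSpace) (n : ℕ) := (hconv f n).hasSum.tendsto_sum_nat
  have hex (f : DirichletSpace) : ∃ g : DirichletSpace, ∀ z ∈ disk,
      HasSum (fun n => (∑' k, l (n + k) * taylorCoeff f k) * z ^ n) (g z) := by
    refine DirichletSpace.exists_hasSum (summable_of_sum_range_le (c := C * S 0 * ‖f‖ ^ 2)
      (fun n => by positivity) fun M => ?_)
    rw [Finset.range_eq_Ico]
    exact hC f _ (hlim f) 0 M
  choose T hT' using hex
  have hT : IsHankelOperator l T := fun f => ⟨_, hlim f, hT' f⟩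
  -- The part of `T f` from the index `N` on is controlled by the tail of the symbol.
  have htail (N : ℕ) (f g : DirichletSpace)
      (hg : ∀ n, taylorCoeff g n = if n < N then 0 else taylorCoeff (T f) n) :
      ‖g‖ ≤ √(C * S N) * ‖f‖ := by
    refine (pow_le_pow_iff_left₀ (norm_nonneg _) (by positivity) two_ne_zero).1 ?_
    rw [mul_pow, Real.sq_sqrt (mul_nonneg hC0 (hS0 N)),
      ← g.hasSum_weight_mul_norm_taylorCoeff_sq.tsum_eq]
    refine Real.tsum_le_of_sum_range_le
      (fun n => mul_nonneg (weight_pos n).le (by positivity)) fun M => ?_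
    refine le_trans ?_ (hC f _ (hT.tendsto_taylorCoeff f) N M)
    have hsub : Finset.Ico N M ⊆ Finset.range M := fun n hn => by
      rw [Finset.mem_Ico] at hn; exact Finset.mem_range.2 hn.2
    rw [← Finset.sum_subset hsub fun n hn hn' => by
      rw [Finset.mem_range] at hn
      rw [Finset.mem_Ico] at hn'
      rw [hg, if_pos (by omega)]
      simp]
    refine Finset.sum_le_sum fun n hn => ?_
    rw [Finset.mem_Ico] at hn
    rw [hg, if_neg (by omega)]
    exact mul_le_mul_of_nonneg_right (weight_le n) (by positivity)
  let A : DirichletSpace →L[ℂ] DirichletSpace :=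
    hT.toLinearMap.mkContinuous (√(C * S 0)) fun f => htail 0 f (T f) fun n => by simp
  have hAT (f : DirichletSpace) : A f = T f := rfl
  have hlimS : Tendsto (fun N => √(C * S N)) atTop (𝓝 0) := by
    have h1 : Tendsto S atTop (𝓝 0) := by
      exact tendsto_sum_nat_add fun n : ℕ => ((n : ℝ) + 1) * ‖l n‖ ^ 2
    have h2 := (Real.continuous_sqrt.tendsto _).comp (h1.const_mul C)
    rwa [mul_zero, Real.sqrt_zero] at h2
  refine ⟨T, hT, ?_⟩
  change IsCompactOperator A
  refine isCompactOperator_of_tendsto (F := fun N => (DirichletSpace.truncation N).comp A)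
    (l := atTop) ?_ (Eventually.of_forall fun N =>
      (DirichletSpace.isCompactOperator_truncation N).comp_clm A)
  rw [tendsto_iff_norm_sub_tendsto_zero]
  refine squeeze_zero (fun _ => norm_nonneg _) (fun N => ?_) hlimS
  rw [norm_sub_rev]
  refine ContinuousLinearMap.opNorm_le_bound _ (Real.sqrt_nonneg _) fun f => ?_
  refine htail N f _ fun n => ?_
  rw [← DirichletSpace.taylorCoeffCLM_apply, _root_.sub_apply, map_sub,
    DirichletSpace.taylorCoeffCLM_apply, DirichletSpace.taylorCoeffCLM_apply,
    ContinuousLinearMap.comp_apply, DirichletSpace.taylorCoeff_truncation, hAT]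
  split_ifs <;> simp

end Tail

end DirichletHankel

end

theorem corollary1p5 (p : ℝ) (hp : 2 < p) (E : Set ℤ) (hE : DirichletHankel.IsLambdaSet p E)
    (l : ℕ → ℂ) (hl : ∀ n : ℕ, (n : ℤ) ∉ E → l n = 0) :
    List.TFAE [
      DirichletHankel.HankelCompact l,
      DirichletHankel.HankelBounded l,
      DirichletHankel.SymbolInDirichlet l,
      Summable (fun n : {n : ℕ // (n : ℤ) ∈ E} => ((n : ℕ) + 1 : ℝ) * ‖l n‖ ^ 2)] := by
  have hsub : Summable (fun n : {n : ℕ // (n : ℤ) ∈ E} => ((n : ℕ) + 1 : ℝ) * ‖l n‖ ^ 2) ↔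
      Summable fun n : ℕ => ((n : ℝ) + 1) * ‖l n‖ ^ 2 := by
    refine (Subtype.val_injective).summable_iff
      (f := fun n : ℕ => ((n : ℝ) + 1) * ‖l n‖ ^ 2) fun n hn => ?_
    rw [hl n fun h => hn ⟨⟨n, h⟩, rfl⟩]
    simp
  tfae_have 1 → 2 := DirichletHankel.HankelCompact.hankelBounded
  tfae_have 2 → 4 := fun h => hsub.2 h.summable
  tfae_have 4 → 1 := fun h => hE.hankelCompact hp hl (hsub.1 h)
  tfae_have 3 ↔ 4 := DirichletHankel.symbolInDirichlet_iff.trans hsub.symm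
  tfae_finish
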